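/- **Setting.** For a real vector space $V$ let $\Lambda^{p,q}(V)$ be the space of $(p,q)$-covectors: multilinear functionals $\varphi(X_1,\dots,X_p;Y_1,\dots,Y_q)$ on $V$, alternating in the $X_i$ and alternating in the $Y_j$. Let $s:\Lambda^{p,q}\to\Lambda^{p+1,q-1}$ and $s^*:\Lambda^{p,q}\to\Lambda^{p-1,q+1}$ be $$(s\varphi)(X_1,\dots,X_{p+1};Y_1,\dots,Y_{q-1})=\sum_{a=1}^{p+1}(-1)^{a-1}\varphi(X_1,\dots,\widehat{X_a},\dots,X_{p+1};X_a,Y_1,\dots,Y_{q-1}),$$ $$(s^*\varphi)(X_1,\dots,X_{p-1};Y_1,\dots,Y_{q+1})=\sum_{a=1}^{q+1}(-1)^{a-1}\varphi(Y_a,X_1,\dots,X_{p-1};Y_1,\dots,\widehat{Y_a},\dots,Y_{q+1})$$ (with $s=0$ if $q=0$), and let $\Lambda^{p,q}_m(V)$ be the eigenspace of $s^*s$ on $\Lambda^{p,q}(V)$ for the eigenvalue $m(m+p-q+1)$. For a simplex $F$, let $\mathcal P_r\Lambda^{p,q}_m(F)$ be the space of fields of $(p,q)$-covectors on (the tangent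 spaces of) $F$ with polynomial coefficients of degree at most $r$ and with values in $\Lambda^{p,q}_m$. For a face $K\le F$ let $\mathrm{tr}^F_K$ be the pullback under the inclusion $K\hookrightarrow F$, and let $\mathring{\mathcal P}_r\Lambda^{p,q}_m(F)$ be the subspace of those forms in $\mathcal P_r\Lambda^{p,q}_m(F)$ whose traces on all proper faces of $F$ vanish. For a finite simplicial complex $\mathcal T$ (realized with affine simplices in a real vector space), with set of nonempty simplices $\mathfrak T$, let $$\mathcal P_r\Lambda^{p,q}_m(\mathcal T)=\Bigl\{(\varphi_F)_{F\in\mathfrak T}\in\prod_{F\in\mathfrak T}\mathcal P_r\Lambda^{p,q}_m(F)\;\Big|\;\mathrm{tr}^F_K\varphi_F=\varphi_K\text{ for all }K\le F\Bigr\},$$ and let $\mathrm{tr}^{\mathcal T}_F$ be the projection to the $F$-component. A family of linear maps $E_K^{\mathcal T}:\mathring{\mathcal P}_r\Lambda^{p,q}_m(K)\to\mathcal P_r\Lambda^{p,q}_m(\mathcal T)$, $K\in\mathfrak T$, is called a family of *local extension operators* if $\mathrm{tr}^{\mathcal T}_KE^{\mathcal T}_K$ is the inclusion for every $K$, and $\mathrm{tr}^{\mathcal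 T}_FE^{\mathcal T}_K=0$ whenever $K\not\le F$. **Theorem.** Let $p,q,m,r\ge 0$ be integers with $\max\{0,q-p\}\le m\le q$ and $(r,m)\ne(0,q)$, and let $\mathcal T$ be a finite simplicial complex. 1. Local extension operators $E_K^{\mathcal T}$ exist. They can be chosen to come from simplicial extension operators: for every $K\in\mathfrak T$ with set of vertices $\{v_0,\dots,v_n\}$ there is a linear map $\varphi\mapsto\varphi'$ from $\mathring{\mathcal P}_r\Lambda^{p,q}_m(K)$ to the space of $(p,q)$-forms on $\mathbb R^{n+1}$ that have homogeneous polynomial coefficients of degree $r$, take values in $\Lambda^{p,q}_m$, and have vanishing trace on all coordinate hyperplanes, such that for every $F\in\mathfrak T$ the form $\mathrm{tr}^{\mathcal T}_FE_K^{\mathcal T}\varphi$ is the pullback of $\varphi'$ under the map $(\lambda_0,\dots,\lambda_n):F\to\mathbb R^{n+1}$, where $\lambda_i$ is the barycentric coordinate of $v_i$ on $F$ ($\lambda_i=0$ if $v_i\notin F$). 2. For every family of local extension operators, $$\mathcal P_r\Lambda^{p,q}_m(\mathcal T)=\bigoplus_{F\in\mathfrak T}E_F^{\mathcal T}\,\mathring{\mathcal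 P}_r\Lambda^{p,q}_m(F).$$ Moreover, given any bases $(b_{F,i})_i$ of the spaces $\mathring{\mathcal P}_r\Lambda^{p,q}_m(F)$, the forms $E_F^{\mathcal T}b_{F,i}$ ($F\in\mathfrak T$, $i$ arbitrary) are a basis of $\mathcal P_r\Lambda^{p,q}_m(\mathcal T)$, and this basis is local: $E_F^{\mathcal T}b_{F,i}$ vanishes on every simplex of $\mathcal T$ that does not contain $F$. -/

import Mathlib

noncomputable section

namespace DoubleForm

/-! ### Double multicovectors and their decomposition -/

/-- The space of `(p, q)`-covectors on `V`: functionals `φ(X₁, …, X_p; Y₁, …, Y_q)` that are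
multilinear, alternating in the first `p` arguments and alternating in the last `q` arguments.
The value is written `φ X Y` with `X : Fin p → V` and `Y : Fin q → V`. -/
abbrev DoubleCovector (p q : ℕ) (V : Type*) [AddCommGroup V] [Module ℝ V] : Type _ :=
  V [⋀^Fin p]→ₗ[ℝ] (V [⋀^Fin q]→ₗ[ℝ] ℝ)

section Algebra

variable {p q : ℕ} {V W : Type*} [AddCommGroup V] [Module ℝ V] [AddCommGroup W] [Module ℝ W]

/-- Pullback of a `(p, q)`-covector along a linear map:
`(f^* φ)(X₁, …; Y₁, …) = φ(f X₁, …; f Y₁, …)`. -/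
def pullback (f : V →ₗ[ℝ] W) : DoubleCovector p q W →ₗ[ℝ] DoubleCovector p q V where
  toFun φ := LinearMap.compAlternatingMap
    { toFun := fun ψ : W [⋀^Fin q]→ₗ[ℝ] ℝ => ψ.compLinearMap f
      map_add' := fun _ _ => rfl
      map_smul' := fun _ _ => rfl } (φ.compLinearMap f)
  map_add' _ _ := rfl
  map_smul' _ _ := rfl

theorem pullback_apply (f : V →ₗ[ℝ] W) (φ : DoubleCovector p q W) (X : Fin p → V)
    (Y : Fin q → V) : pullback f φ X Y = φ (fun i => f (X i)) (fun i => f (Y i)) := rfl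

/-- The Bianchi sum `s : Λ^{p,q+1} → Λ^{p+1,q}`,
`(s φ)(X₀, …, X_p; Y) = ∑ₐ (-1)ᵃ φ(X₀, …, X̂ₐ, …, X_p; Xₐ, Y)`. -/
def bianchi : DoubleCovector p (q + 1) V →ₗ[ℝ] DoubleCovector (p + 1) q V where
  toFun φ := AlternatingMap.alternatizeUncurryFin
    { toFun := fun x => (AlternatingMap.curryLeftLinearMap.flip x).compAlternatingMap φ
      map_add' := fun x y => by ext X Y; simp
      map_smul' := fun c x => by ext X Y; simp }
  map_add' φ ψ := by
    ext X : 1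
    simp [AlternatingMap.alternatizeUncurryFin_apply, Finset.sum_add_distrib]
  map_smul' c φ := by
    ext X : 1
    simp only [AlternatingMap.alternatizeUncurryFin_apply, LinearMap.coe_mk, AddHom.coe_mk,
      AlternatingMap.smul_apply, Finset.smul_sum, RingHom.id_apply,
      LinearMap.compAlternatingMap_apply, map_smul]
    exact Finset.sum_congr rfl fun k _ => smul_comm _ _ _

/-- The operator `s^* : Λ^{p+1,q} → Λ^{p,q+1}`,
`(s^* φ)(X; Y₀, …, Y_q) = ∑ₐ (-1)ᵃ φ(Yₐ, X; Y₀, …, Ŷₐ, …, Y_q)`. -/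
def bianchiStar : DoubleCovector (p + 1) q V →ₗ[ℝ] DoubleCovector p (q + 1) V where
  toFun φ :=
    { toFun := fun X => AlternatingMap.alternatizeUncurryFin
        { toFun := fun y => φ.curryLeft y X
          map_add' := fun x y => by simp
          map_smul' := fun c x => by simp }
      map_update_add' := fun X i x y => by
        ext Y
        simp only [AlternatingMap.alternatizeUncurryFin_apply, LinearMap.coe_mk, AddHom.coe_mk,
          AlternatingMap.map_update_add, AlternatingMap.add_apply, smul_add,
          Finset.sum_add_distrib]
        rfl
      map_update_smul' := fun X i c x => by
        ext Y
        simp only [AlternatingMap.alternatizeUncurryFin_apply, LinearMap.coe_mk, AddHom.coe_mk,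
          AlternatingMap.map_update_smul, AlternatingMap.smul_apply, Finset.smul_sum]
        exact Finset.sum_congr rfl fun k _ => smul_comm _ _ _
      map_eq_zero_of_eq' := fun X i j hX hij => by
        ext Y
        simp only [AlternatingMap.alternatizeUncurryFin_apply, LinearMap.coe_mk, AddHom.coe_mk,
          AlternatingMap.map_eq_zero_of_eq _ X hX hij, AlternatingMap.zero_apply, smul_zero,
          Finset.sum_const_zero] }
  map_add' φ ψ := by
    ext X Y
    simp [AlternatingMap.alternatizeUncurryFin_apply, Finset.sum_add_distrib]
  map_smul' c φ := by
    ext X Y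
    simp only [AlternatingMap.alternatizeUncurryFin_apply, LinearMap.coe_mk, AddHom.coe_mk,
      AlternatingMap.smul_apply, Finset.smul_sum, RingHom.id_apply, AlternatingMap.coe_mk,
      MultilinearMap.coe_mk, AlternatingMap.curryLeft_smul, LinearMap.smul_apply]
    exact Finset.sum_congr rfl fun k _ => smul_comm _ _ _

/-- The operator `s^* s : Λ^{p,q} → Λ^{p,q}`; it is zero for `q = 0`, since then `s` takes values
in the zero space. -/
def bianchiStarBianchi (p : ℕ) (V : Type*) [AddCommGroup V] [Module ℝ V] :
    (q : ℕ) → Module.End ℝ (DoubleCovector p q V)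
  | 0 => 0
  | _ + 1 => bianchiStar ∘ₗ bianchi

/-- `Λ^{p,q}_m`: the eigenspace of `s^* s` for the eigenvalue `m (m + p - q + 1)`. -/
def summand (p q m : ℕ) (V : Type*) [AddCommGroup V] [Module ℝ V] :
    Submodule ℝ (DoubleCovector p q V) :=
  Module.End.eigenspace (R := ℝ) (M := DoubleCovector p q V) (bianchiStarBianchi p V q)
    ((m : ℝ) * ((m : ℝ) + (p : ℝ) - (q : ℝ) + 1))

end Algebra

/-! ### Polynomial double forms on a simplex

A simplex is given by the finite set `F` of its vertices in a real vector space `E`; its points form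
`convexHull ℝ F`, and its tangent space at every point is `vectorSpan ℝ F`. -/

section Simplex

variable {E : Type*} [AddCommGroup E] [Module ℝ E]

/-- `w` is a system of coefficients, supported in `F`, with sum `a` and with `∑ w_v v = x`.
If `F` is affinely independent, then for `a = 1` these are the barycentric coordinates
`λ_v(x)` of a point `x` of the affine span of `F`, and for `a = 0` they are the values `dλ_v(x)` at
a vector `x` tangent to `F`. -/
def IsBary (F : Finset E) (a : ℝ) (w : E → ℝ) (x : E) : Prop :=
  (∀ v, v ∉ F → w v = 0) ∧ ∑ v ∈ F, w v = a ∧ ∑ v ∈ F, w v • v = x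

/-- The points of the simplex with vertex set `F`. -/
abbrev Points (F : Finset E) : Type _ := ↥(convexHull ℝ (F : Set E))

/-- The tangent space of the simplex with vertex set `F`. -/
abbrev Tangent (F : Finset E) : Type _ := ↥(vectorSpan ℝ (F : Set E))

/-- Arbitrary fields of `(p, q)`-covectors on the simplex `F`. -/
abbrev FormOn (p q : ℕ) (F : Finset E) : Type _ := Points F → DoubleCovector p q (Tangent F)

/-- A real function on the simplex `F` that is a polynomial of degree at most `r` (in the
barycentric coordinates). -/
def IsPolyOn (r : ℕ) (F : Finset E) (f : Points F → ℝ) : Prop :=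
  ∃ P : MvPolynomial F ℝ, P.totalDegree ≤ r ∧
    ∀ (x : Points F) (w : E → ℝ), IsBary F 1 w x → f x = MvPolynomial.eval (fun v : F => w v) P

/-- `P_r Λ^{p,q}_m(F)`: the double forms on `F` whose coefficients are polynomials of degree at most
`r` and that belong pointwise to `Λ^{p,q}_m`. -/
def polyForms (r p q m : ℕ) (F : Finset E) : Submodule ℝ (FormOn p q F) where
  carrier := {φ | (∀ (X : Fin p → Tangent F) (Y : Fin q → Tangent F),
      IsPolyOn r F fun x => φ x X Y) ∧ ∀ x, φ x ∈ summand p q m (Tangent F)}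
  zero_mem' := ⟨fun _ _ => ⟨0, by simp, by simp⟩, fun _ => Submodule.zero_mem _⟩
  add_mem' := by
    rintro φ ψ ⟨h₁, h₂⟩ ⟨h₃, h₄⟩
    refine ⟨fun X Y => ?_, fun x => Submodule.add_mem _ (h₂ x) (h₄ x)⟩
    obtain ⟨P, hP, hP'⟩ := h₁ X Y
    obtain ⟨Q, hQ, hQ'⟩ := h₃ X Y
    exact ⟨P + Q, (MvPolynomial.totalDegree_add P Q).trans (max_le hP hQ),
      fun x w hw => by simp [hP' x w hw, hQ' x w hw]⟩
  smul_mem' := by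
    rintro c φ ⟨h₁, h₂⟩
    refine ⟨fun X Y => ?_, fun x => Submodule.smul_mem _ c (h₂ x)⟩
    obtain ⟨P, hP, hP'⟩ := h₁ X Y
    exact ⟨c • P, (MvPolynomial.totalDegree_smul_le c P).trans hP,
      fun x w hw => by simp [hP' x w hw]⟩

/-- The trace `tr^F_K`: the pullback of double forms under the inclusion `K ↪ F` of a face. -/
def trace {p q : ℕ} {K F : Finset E} (h : K ⊆ F) : FormOn p q F →ₗ[ℝ] FormOn p q K where
  toFun φ x := pullback (Submodule.inclusion (vectorSpan_mono ℝ (Finset.coe_subset.2 h)))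
    (φ ⟨x, convexHull_mono (Finset.coe_subset.2 h) x.2⟩)
  map_add' _ _ := by ext; rfl
  map_smul' _ _ := by ext; rfl

/-- The double forms in `P_r Λ^{p,q}_m(F)` with vanishing trace on the boundary of `F`, i.e. on all
proper faces of `F`. -/
def polyFormsVanishing (r p q m : ℕ) (F : Finset E) : Submodule ℝ (FormOn p q F) :=
  polyForms r p q m F ⊓ ⨅ (K : Finset E) (h : K ⊂ F), LinearMap.ker (trace h.subset)

end Simplex

/-! ### Homogeneous polynomial double forms on a coordinate space -/

/-- The double forms on `ℝ^ι` that have homogeneous polynomial coefficients of degree `r`, belong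
pointwise to `Λ^{p,q}_m`, and have vanishing trace on all coordinate hyperplanes `{λ_i = 0}`. -/
def homFormsVanishing (r p q m : ℕ) (ι : Type*) :
    Submodule ℝ ((ι → ℝ) → DoubleCovector p q (ι → ℝ)) where
  carrier := {Ψ |
    (∀ X Y, ∃ P : MvPolynomial ι ℝ, P.IsHomogeneous r ∧ ∀ x, Ψ x X Y = MvPolynomial.eval x P) ∧
    (∀ x, Ψ x ∈ summand p q m (ι → ℝ)) ∧
    ∀ (i : ι) (x : ι → ℝ) (X : Fin p → ι → ℝ) (Y : Fin q → ι → ℝ),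
      x i = 0 → (∀ j, X j i = 0) → (∀ j, Y j i = 0) → Ψ x X Y = 0}
  zero_mem' := ⟨fun _ _ => ⟨0, MvPolynomial.isHomogeneous_zero _ _ _, by simp⟩,
    fun _ => Submodule.zero_mem _, by simp⟩
  add_mem' := by
    rintro φ ψ ⟨h₁, h₂, h₃⟩ ⟨h₄, h₅, h₆⟩
    refine ⟨fun X Y => ?_, fun x => Submodule.add_mem _ (h₂ x) (h₅ x),
      fun i x X Y hx hX hY => by simp [h₃ i x X Y hx hX hY, h₆ i x X Y hx hX hY]⟩
    obtain ⟨P, hP, hP'⟩ := h₁ X Y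
    obtain ⟨Q, hQ, hQ'⟩ := h₄ X Y
    exact ⟨P + Q, hP.add hQ, fun x => by simp [hP' x, hQ' x]⟩
  smul_mem' := by
    rintro c φ ⟨h₁, h₂, h₃⟩
    refine ⟨fun X Y => ?_, fun x => Submodule.smul_mem _ c (h₂ x),
      fun i x X Y hx hX hY => by simp [h₃ i x X Y hx hX hY]⟩
    obtain ⟨P, hP, hP'⟩ := h₁ X Y
    exact ⟨c • P, (MvPolynomial.homogeneousSubmodule ι ℝ r).smul_mem c hP,
      fun x => by simp [hP' x]⟩

section Triangulation

variable {E : Type*} [AddCommGroup E] [Module ℝ E]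

/-- The double form `φ` on the simplex `F` is the pullback of the double form `Ψ` on `ℝ^K` under the
affine map `F → ℝ^K` given by the barycentric coordinates `λ_k`, `k ∈ K`, of the points of `F`
(where `λ_k = 0` on `F` for `k ∉ F`). -/
def IsBaryPullback {p q : ℕ} (K F : Finset E) (Ψ : (K → ℝ) → DoubleCovector p q (K → ℝ))
    (φ : FormOn p q F) : Prop :=
  ∀ (x : Points F) (X : Fin p → Tangent F) (Y : Fin q → Tangent F)
    (w : E → ℝ) (a : Fin p → E → ℝ) (b : Fin q → E → ℝ),
    IsBary F 1 w x → (∀ j, IsBary F 0 (a j) (X j)) → (∀ j, IsBary F 0 (b j) (Y j)) →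
      φ x X Y = Ψ (fun k => w k) (fun j k => a j k) (fun j k => b j k)

/-- `P_r Λ^{p,q}_m(𝒯)`: families `(φ_F)_F` of double forms `φ_F ∈ P_r Λ^{p,q}_m(F)`, indexed by all
simplices `F` of `𝒯`, such that `tr^F_K φ_F = φ_K` whenever `K` is a face of `F`. -/
def globalForms (T : Geometry.SimplicialComplex ℝ E) (r p q m : ℕ) :
    Submodule ℝ (∀ F : T.faces, FormOn p q F.1) where
  carrier := {φ | (∀ F, φ F ∈ polyForms r p q m F.1) ∧
    ∀ (K F : T.faces) (h : K.1 ⊆ F.1), trace h (φ F) = φ K}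
  zero_mem' := ⟨fun _ => Submodule.zero_mem _, fun _ _ _ => map_zero _⟩
  add_mem' := fun ha hb => ⟨fun F => Submodule.add_mem _ (ha.1 F) (hb.1 F),
    fun K F h => by simp [ha.2 K F h, hb.2 K F h]⟩
  smul_mem' := fun c _ ha => ⟨fun F => Submodule.smul_mem _ c (ha.1 F),
    fun K F h => by simp [ha.2 K F h]⟩

/-- The trace `tr^𝒯_F : P_r Λ^{p,q}_m(𝒯) → P_r Λ^{p,q}_m(F)`, the projection to the component
at `F`. -/
def globalTrace {T : Geometry.SimplicialComplex ℝ E} {r p q m : ℕ} (F : T.faces) :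
    globalForms T r p q m →ₗ[ℝ] polyForms r p q m F.1 where
  toFun φ := ⟨φ.1 F, φ.2.1 F⟩
  map_add' _ _ := rfl
  map_smul' _ _ := rfl

/-- The linear maps `E_K^𝒯` from the vanishing-trace spaces on the simplices `K` of `𝒯` to
`P_r Λ^{p,q}_m(𝒯)` are local extension operators: `tr^𝒯_K E_K^𝒯` is the inclusion, and
`tr^𝒯_F E_K^𝒯 = 0` unless `K` is a face of `F`. -/
structure IsLocalExtension {T : Geometry.SimplicialComplex ℝ E} {r p q m : ℕ}
    (ext : ∀ K : T.faces, polyFormsVanishing r p q m K.1 →ₗ[ℝ] globalForms T r p q m) :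
    Prop where
  trace_self : ∀ K φ, (globalTrace K (ext K φ)).1 = φ.1
  trace_eq_zero : ∀ K F : T.faces, ¬ K.1 ⊆ F.1 → globalTrace F ∘ₗ ext K = 0

end Triangulation

end DoubleForm

end

noncomputable section

namespace DoubleForm

/-! ### Algebra of double covectors and the operator `s^* s`. -/

section Algebra

open Function (update)

variable {p q : ℕ} {V W : Type*} [AddCommGroup V] [Module ℝ V] [AddCommGroup W] [Module ℝ W]

/-! The operator `s^* s` equals `q` minus `swapSum`, so membership in `summand` is a linear equation
in `φ`, preserved by pullbacks and by passing to coefficients.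

Part 1 comes down to one simplex `K`: a form with vanishing trace lifts to a homogeneous form on
`ℝ^K` with vanishing trace on the coordinate hyperplanes (`exists_homogeneous_lift`). Locality is
then automatic, since a simplex not containing `K` is mapped into a coordinate hyperplane. Write `φ
= ∑ λ^d ψ_d`, homogeneous of degree `r` in the barycentric coordinates, with constant covectors
`ψ_d`. If `d i = 0`, the vanishing trace on the face opposite `i` makes `ψ_d` vanish on the tangent
space of that face.

For `d ≠ 0`, choose a vertex `o` with `d o ≠ 0` and pull `ψ_d` back along the projection `e_v ↦ v -
o` (`coneProj`). On `x_i = 0` the monomial vanishes if `d i ≠ 0`; otherwise the projection lands in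
the tangent space of the face opposite `i`.

For `d = 0` one has `r = 0`, hence `m < q`, and no such vertex. Instead, contract `ψ` twice with
each edge `v_i - v_j`, multiply by `dλ_i ⊗ dλ_j + dλ_j ⊗ dλ_i` and sum. Symmetry of this factor
keeps the result in the eigenspace (`symmSubstitute_mem_summand`), and its restriction to the
simplex is `-2 (pq ψ + swapSum ψ) = -2 (q - m)(m + p + 1) ψ` (`sum_symmSubstitute`), a nonzero
multiple of `ψ`.

Part 2 is triangularity with respect to inclusion of faces: at `F`, only extensions from faces of
`F` contribute, and the one from `F` itself contributes the identity. -/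

theorem neg_one_pow_smul_map_vecCons_removeNth {N : Type*} [AddCommGroup N] [Module ℝ N] {n : ℕ}
    (f : V [⋀^Fin (n + 1)]→ₗ[ℝ] N) (a : Fin (n + 1)) (v : V) (X : Fin (n + 1) → V) :
    (-1) ^ (a : ℕ) • f (Matrix.vecCons v (a.removeNth X)) = f (update X a v) := by
  rw [← AlternatingMap.map_insertNth, Fin.insertNth_removeNth]

theorem alternatingMap_sum_apply {N ι κ : Type*} [AddCommGroup N] [Module ℝ N] (S : Finset κ)
    (f : κ → V [⋀^ι]→ₗ[ℝ] N) (X : ι → V) : (∑ k ∈ S, f k) X = ∑ k ∈ S, f k X :=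
  map_sum (⟨⟨fun g => g X, rfl⟩, fun _ _ => rfl⟩ : (V [⋀^ι]→ₗ[ℝ] N) →+ N) f S

/-- The sum of the values of a double covector after exchanging one of the first arguments with one
of the last arguments. -/
def swapSum (φ : DoubleCovector p q V) (X : Fin p → V) (Y : Fin q → V) : ℝ :=
  ∑ a, ∑ b, φ (update X a (Y b)) (update Y b (X a))

theorem bianchi_apply (φ : DoubleCovector p (q + 1) V) (X : Fin (p + 1) → V) (Y : Fin q → V) :
    bianchi φ X Y =
      ∑ a : Fin (p + 1), (-1) ^ (a : ℕ) * φ (a.removeNth X) (Matrix.vecCons (X a) Y) := by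
  simp [bianchi, AlternatingMap.alternatizeUncurryFin_apply, alternatingMap_sum_apply]

theorem bianchiStar_apply (φ : DoubleCovector (p + 1) q V) (X : Fin p → V)
    (Y : Fin (q + 1) → V) :
    bianchiStar φ X Y = ∑ b : Fin (q + 1),
      (-1) ^ (b : ℕ) * φ (Matrix.vecCons (Y b) X) (b.removeNth Y) := by
  simp [bianchiStar, AlternatingMap.alternatizeUncurryFin_apply]

/-- In the expansion of `s^* s`, removing the `Y b` just inserted gives back `φ`, once for each `b`.
Every other term exchanges some `X a` with some `Y b`, with total sign `-1`. -/
theorem bianchiStarBianchi_apply (φ : DoubleCovector p q V) (X : Fin p → V) (Y : Fin q → V) :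
    bianchiStarBianchi p V q φ X Y = q * φ X Y - swapSum φ X Y := by
  cases q with
  | zero => simp [bianchiStarBianchi, swapSum]
  | succ q =>
    have first (b : Fin (q + 1)) :
        (-1) ^ (b : ℕ) * φ X (Matrix.vecCons (Y b) (b.removeNth Y)) = φ X Y := by
      have := neg_one_pow_smul_map_vecCons_removeNth (φ X) b (Y b) Y
      simpa using this
    have second (b : Fin (q + 1)) :
        (-1) ^ (b : ℕ) * ∑ a : Fin p, (-1) ^ ((a : ℕ) + 1) *
          φ (a.succ.removeNth (Matrix.vecCons (Y b) X)) (Matrix.vecCons (X a) (b.removeNth Y)) =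
        - ∑ a, φ (update X a (Y b)) (update Y b (X a)) := by
      rw [Finset.mul_sum, ← Finset.sum_neg_distrib]
      refine Finset.sum_congr rfl fun a _ => ?_
      cases p with
      | zero => exact a.elim0
      | succ p =>
        have h : a.succ.removeNth (Matrix.vecCons (Y b) X)
            = Matrix.vecCons (Y b) (a.removeNth X) := by
          ext i
          refine Fin.cases ?_ (fun i => ?_) i <;> simp [Fin.removeNth]
        rw [h, ← neg_one_pow_smul_map_vecCons_removeNth φ,
          ← neg_one_pow_smul_map_vecCons_removeNth _ b]
        simp [AlternatingMap.smul_apply, pow_succ]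
    change bianchiStar (bianchi φ) X Y = _
    simp only [bianchiStar_apply, bianchi_apply, Fin.sum_univ_succ (n := p), mul_add]
    simp only [Fin.val_zero, pow_zero, one_mul, Fin.val_succ, Matrix.cons_val_zero,
      Matrix.cons_val_succ, Finset.sum_add_distrib, second]
    have hz (b : Fin (q + 1)) : (0 : Fin (p + 1)).removeNth (Matrix.vecCons (Y b) X) = X := by
      ext i
      simp [Fin.removeNth]
    simp only [hz, first]
    rw [swapSum, Finset.sum_comm]
    simp [Finset.sum_neg_distrib, sub_eq_add_neg]

theorem mem_summand_iff {m : ℕ} {φ : DoubleCovector p q V} :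
    φ ∈ summand p q m V ↔ ∀ X Y,
      swapSum φ X Y = (q - (m : ℝ) * ((m : ℝ) + (p : ℝ) - (q : ℝ) + 1)) * φ X Y := by
  rw [summand, Module.End.mem_eigenspace_iff]
  constructor
  · intro h X Y
    have := congr($h X Y)
    rw [bianchiStarBianchi_apply] at this
    simp only [AlternatingMap.smul_apply, smul_eq_mul] at this
    linarith
  · intro h
    ext X Y
    rw [bianchiStarBianchi_apply, h]
    simp only [AlternatingMap.smul_apply, smul_eq_mul]
    ring

theorem swapSum_pullback (f : V →ₗ[ℝ] W) (φ : DoubleCovector p q W) (X : Fin p → V)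
    (Y : Fin q → V) :
    swapSum (pullback f φ) X Y = swapSum φ (fun i => f (X i)) (fun i => f (Y i)) := by
  have h {n : ℕ} (Z : Fin n → V) (a : Fin n) (v : V) :
      (fun i => f (update Z a v i)) = update (fun i => f (Z i)) a (f v) := by
    ext i
    exact Function.apply_update (fun _ => f) Z a v i
  simp [swapSum, pullback_apply, h]

theorem pullback_mem_summand {m : ℕ} (f : V →ₗ[ℝ] W) {φ : DoubleCovector p q W}
    (hφ : φ ∈ summand p q m W) : pullback f φ ∈ summand p q m V := by
  rw [mem_summand_iff] at hφ ⊢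
  intro X Y
  rw [swapSum_pullback, hφ, pullback_apply]

/-! ### Contraction with `v ⊗ v` followed by multiplication with a symmetric form. -/

/-- `φ ↦ ∑ₐ α(Xₐ) φ(X₁, …, v, …, X_p)` with `v` in the place of `Xₐ`, the composition of the
exterior product with `α` and the contraction with `v`. -/
def substitute {N : Type*} [AddCommGroup N] [Module ℝ N] {n : ℕ} (α : V →ₗ[ℝ] ℝ) (v : V)
    (f : V [⋀^Fin (n + 1)]→ₗ[ℝ] N) : V [⋀^Fin (n + 1)]→ₗ[ℝ] N :=
  AlternatingMap.alternatizeUncurryFin (α.smulRight (f.curryLeft v))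

theorem substitute_apply {N : Type*} [AddCommGroup N] [Module ℝ N] {n : ℕ} (α : V →ₗ[ℝ] ℝ) (v : V)
    (f : V [⋀^Fin (n + 1)]→ₗ[ℝ] N) (X : Fin (n + 1) → V) :
    substitute α v f X = ∑ a, α (X a) • f (update X a v) := by
  simp only [substitute, AlternatingMap.alternatizeUncurryFin_apply]
  refine Finset.sum_congr rfl fun a _ => ?_
  rw [← neg_one_pow_smul_map_vecCons_removeNth]
  simp only [LinearMap.smulRight_apply, AlternatingMap.smul_apply,
    AlternatingMap.curryLeft_apply_apply]
  exact smul_comm _ _ _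

/-- The map `substitute` on the last arguments and on the first arguments of a double covector. -/
def doubleSubstitute (α β : V →ₗ[ℝ] ℝ) (v : V) (φ : DoubleCovector (p + 1) (q + 1) V) :
    DoubleCovector (p + 1) (q + 1) V :=
  substitute α v (LinearMap.compAlternatingMap
    { toFun := substitute β v
      map_add' := fun f g => by ext; simp [substitute_apply, mul_add, Finset.sum_add_distrib]
      map_smul' := fun c f => by
        ext
        simp only [substitute_apply, AlternatingMap.smul_apply, smul_eq_mul, Finset.mul_sum,
          RingHom.id_apply]
        exact Finset.sum_congr rfl fun _ _ => by ring } φ)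

theorem doubleSubstitute_apply (α β : V →ₗ[ℝ] ℝ) (v : V) (φ : DoubleCovector (p + 1) (q + 1) V)
    (X : Fin (p + 1) → V) (Y : Fin (q + 1) → V) :
    doubleSubstitute α β v φ X Y =
      ∑ a, ∑ b, α (X a) * β (Y b) * φ (update X a v) (update Y b v) := by
  simp [doubleSubstitute, substitute_apply, alternatingMap_sum_apply, Finset.mul_sum, mul_assoc]

theorem sum_sum_eq_zero_of_antisymm {ι : Type*} [Fintype ι] (f : ι → ι → ℝ)
    (hf : ∀ i j, f i j = - f j i) : ∑ i, ∑ j, f i j = 0 := by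
  have h : ∑ i, ∑ j, f i j = - ∑ i, ∑ j, f i j := by
    conv_lhs => rw [Finset.sum_comm]
    simp only [← Finset.sum_neg_distrib]
    exact Finset.sum_congr rfl fun i _ => Finset.sum_congr rfl fun j _ => hf j i
  linarith

theorem map_update_update_swap {N : Type*} [AddCommGroup N] [Module ℝ N] {n : ℕ}
    (f : V [⋀^Fin n]→ₗ[ℝ] N) (X : Fin n → V) {i j : Fin n} (h : i ≠ j) (v w : V) :
    f (update (update X i v) j w) = - f (update (update X j v) i w) := by
  have h' : update (update X i v) j w = update (update X j v) i w ∘ Equiv.swap i j := by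
    ext k
    rcases eq_or_ne k i with rfl | hi
    · simp [Function.update_of_ne h, Function.update_of_ne h.symm]
    rcases eq_or_ne k j with rfl | hj
    · simp
    simp [Equiv.swap_apply_of_ne_of_ne hi hj, hi, hj]
  rw [h', AlternatingMap.map_swap _ _ h]

/-- The swap sum commutes with this operation when `g` is symmetric. A swap at `(c, d)` and a
substitution at `(a, b)` commute if both indices differ; if exactly one agrees, the surplus terms
are antisymmetric in the two remaining positions and cancel. -/
theorem sum_swap_mul_symm (g : V → V → ℝ) (hg : ∀ x y, g x y = g y x) (v : V)
    (φ : DoubleCovector p q V) (X : Fin p → V) (Y : Fin q → V) :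
    ∑ c, ∑ d, ∑ a, ∑ b, g (update X c (Y d) a) (update Y d (X c) b) *
        φ (update (update X c (Y d)) a v) (update (update Y d (X c)) b v) =
      ∑ a, ∑ b, g (X a) (Y b) * swapSum φ (update X a v) (update Y b v) := by
  -- `R` substitutes before swapping. If exactly one of `a = c`, `b = d` holds, `R` vanishes because
  -- `v` occurs twice among arguments of one kind, and `E₁` or `E₂` is the term of the left side.
  let R (c : Fin p) (d : Fin q) (a : Fin p) (b : Fin q) : ℝ := g (X a) (Y b) *
    φ (update (update X a v) c (update Y b v d)) (update (update Y b v) d (update X a v c))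
  let E₁ (c : Fin p) (d b : Fin q) : ℝ := if b = d then 0 else
    g (Y d) (Y b) * φ (update X c v) (update (update Y d (X c)) b v)
  let E₂ (d : Fin q) (c a : Fin p) : ℝ := if a = c then 0 else
    g (X a) (X c) * φ (update (update X c (Y d)) a v) (update Y d v)
  have key (c d a b) : g (update X c (Y d) a) (update Y d (X c) b) *
        φ (update (update X c (Y d)) a v) (update (update Y d (X c)) b v) =
      R c d a b + (if a = c then E₁ c d b else 0) + (if b = d then E₂ d c a else 0) := by
    simp only [R, E₁, E₂]
    by_cases ha : a = c <;> by_cases hb : b = d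
    · subst ha hb
      simp [hg (Y b)]
    · subst ha
      have : φ (update X a (Y d)) (update (update Y b v) d v) = 0 := by
        refine AlternatingMap.map_eq_zero_of_eq _ _ (i := b) (j := d) ?_ hb
        simp [hb]
      simp [hb, Ne.symm hb, this]
    · subst hb
      have : φ (update (update X a v) c v) = 0 := by
        refine AlternatingMap.map_eq_zero_of_eq _ _ (i := a) (j := c) ?_ ha
        simp [ha]
      simp [ha, Ne.symm ha, this]
    · simp [ha, hb, Ne.symm ha, Ne.symm hb, Function.update_comm ha, Function.update_comm hb]
  have h₁ (c) : ∑ d, ∑ b, E₁ c d b = 0 := by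
    refine sum_sum_eq_zero_of_antisymm _ fun d b => ?_
    by_cases h : b = d
    · simp [E₁, h]
    · simp only [E₁, h, Ne.symm h, if_false]
      rw [hg, map_update_update_swap _ _ h, mul_neg]
      simp
  have h₂ (d) : ∑ c, ∑ a, E₂ d c a = 0 := by
    refine sum_sum_eq_zero_of_antisymm _ fun c a => ?_
    by_cases h : a = c
    · simp [E₂, h]
    · simp only [E₂, h, Ne.symm h, if_false]
      rw [hg, map_update_update_swap _ _ h]
      simp
  have hR : ∑ c, ∑ d, ∑ a, ∑ b, R c d a b =
      ∑ a, ∑ b, g (X a) (Y b) * swapSum φ (update X a v) (update Y b v) := by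
    simp only [swapSum, Finset.mul_sum]
    calc ∑ c, ∑ d, ∑ a, ∑ b, R c d a b = ∑ c, ∑ a, ∑ b, ∑ d, R c d a b := by
          refine Finset.sum_congr rfl fun c _ => ?_
          rw [Finset.sum_comm]
          exact Finset.sum_congr rfl fun a _ => Finset.sum_comm
      _ = ∑ a, ∑ b, ∑ c, ∑ d, R c d a b := by
          rw [Finset.sum_comm]
          exact Finset.sum_congr rfl fun a _ => Finset.sum_comm
  have h₁' : ∑ c, ∑ d, ∑ a, ∑ b, (if a = c then E₁ c d b else 0) = 0 := by
    refine Finset.sum_eq_zero fun c _ => ?_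
    refine Eq.trans ?_ (h₁ c)
    refine Finset.sum_congr rfl fun d _ => ?_
    rw [Finset.sum_comm]
    simp
  have h₂' : ∑ c, ∑ d, ∑ a, ∑ b, (if b = d then E₂ d c a else 0) = 0 := by
    rw [Finset.sum_comm]
    refine Finset.sum_eq_zero fun d _ => ?_
    refine Eq.trans ?_ (h₂ d)
    simp
  simp only [key, Finset.sum_add_distrib, hR, h₁', h₂', add_zero]

/-- The exterior product with the symmetrization of `α ⊗ β` of the contraction of a double covector
with `v ⊗ v`. -/
def symmSubstitute (α β : V →ₗ[ℝ] ℝ) (v : V) (φ : DoubleCovector (p + 1) (q + 1) V) :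
    DoubleCovector (p + 1) (q + 1) V :=
  doubleSubstitute α β v φ + doubleSubstitute β α v φ

theorem symmSubstitute_apply (α β : V →ₗ[ℝ] ℝ) (v : V) (φ : DoubleCovector (p + 1) (q + 1) V)
    (X : Fin (p + 1) → V) (Y : Fin (q + 1) → V) :
    symmSubstitute α β v φ X Y = ∑ a, ∑ b,
      (α (X a) * β (Y b) + β (X a) * α (Y b)) * φ (update X a v) (update Y b v) := by
  simp [symmSubstitute, doubleSubstitute_apply, add_mul, Finset.sum_add_distrib]

theorem symmSubstitute_mem_summand {m : ℕ} (α β : V →ₗ[ℝ] ℝ) (v : V)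
    {φ : DoubleCovector (p + 1) (q + 1) V} (hφ : φ ∈ summand (p + 1) (q + 1) m V) :
    symmSubstitute α β v φ ∈ summand (p + 1) (q + 1) m V := by
  rw [mem_summand_iff] at hφ ⊢
  intro X Y
  rw [swapSum]
  simp only [symmSubstitute_apply]
  rw [sum_swap_mul_symm (fun x y => α x * β y + β x * α y) (fun x y => by ring)]
  simp only [hφ, Finset.mul_sum]
  refine Finset.sum_congr rfl fun a _ => Finset.sum_congr rfl fun b _ => ?_
  ring

end Algebra

/-! ### Barycentric coordinates and pullback from coordinate space. -/

section Barycentric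

variable {E : Type*} [AddCommGroup E] [Module ℝ E] {K F : Finset E} {a b : ℝ} {w z : E → ℝ}
  {x y : E}

theorem IsBary.add (hw : IsBary F a w x) (hz : IsBary F b z y) :
    IsBary F (a + b) (w + z) (x + y) :=
  ⟨fun v hv => by simp [hw.1 v hv, hz.1 v hv],
    by simp [Finset.sum_add_distrib, hw.2.1, hz.2.1],
    by simp [Finset.sum_add_distrib, add_smul, hw.2.2, hz.2.2]⟩

theorem IsBary.smul (hw : IsBary F a w x) (c : ℝ) : IsBary F (c * a) (c • w) (c • x) :=
  ⟨fun v hv => by simp [hw.1 v hv], by simp [← Finset.mul_sum, hw.2.1],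
    by simp [← smul_smul, ← Finset.smul_sum, hw.2.2]⟩

theorem isBary_zero : IsBary F 0 0 (0 : E) := ⟨by simp, by simp, by simp⟩

theorem isBary_single [DecidableEq E] (hx : x ∈ F) : IsBary F 1 (Pi.single x 1) x := by
  refine ⟨fun v hv => Pi.single_eq_of_ne (by rintro rfl; exact hv hx) _, ?_, ?_⟩
  · simp [Pi.single_apply, hx]
  · simp [Pi.single_apply, hx]

theorem IsBary.mono (hw : IsBary K a w x) (h : K ⊆ F) : IsBary F a w x := by
  refine ⟨fun v hv => hw.1 v fun hK => hv (h hK), ?_, ?_⟩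
  · rw [← hw.2.1]
    exact (Finset.sum_subset h fun v _ hv => hw.1 v hv).symm
  · rw [← hw.2.2]
    exact (Finset.sum_subset h fun v _ hv => by simp [hw.1 v hv]).symm

theorem IsBary.unique (hF : AffineIndependent ℝ ((↑) : F → E)) (hw : IsBary F a w x)
    (hz : IsBary F a z x) : w = z := by
  rw [affineIndependent_iff] at hF
  ext v
  by_cases hv : v ∈ F
  · have h := hF Finset.univ (fun u => w u - z u)
      (by
        rw [Finset.sum_coe_sort F (fun u => w u - z u), Finset.sum_sub_distrib, hw.2.1, hz.2.1,
          sub_self])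
      (by
        rw [Finset.sum_coe_sort F (fun u => (w u - z u) • u)]
        simp [sub_smul, Finset.sum_sub_distrib, hw.2.2, hz.2.2])
      ⟨v, hv⟩ (Finset.mem_univ _)
    exact sub_eq_zero.1 h
  · rw [hw.1 v hv, hz.1 v hv]

theorem exists_isBary_of_mem_vectorSpan (hx : x ∈ vectorSpan ℝ (F : Set E)) :
    ∃ w, IsBary F 0 w x := by
  classical
  rw [vectorSpan_def] at hx
  induction hx using Submodule.span_induction with
  | mem x hx =>
    obtain ⟨u, hu, v, hv, rfl⟩ := hx
    refine ⟨Pi.single u 1 + (-1 : ℝ) • Pi.single v 1, ?_⟩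
    have h := (isBary_single (Finset.mem_coe.1 hu)).add
      ((isBary_single (Finset.mem_coe.1 hv)).smul (-1))
    simpa [sub_eq_add_neg] using h
  | zero => exact ⟨0, isBary_zero⟩
  | add x y _ _ hx hy =>
    obtain ⟨w, hw⟩ := hx
    obtain ⟨z, hz⟩ := hy
    exact ⟨w + z, by simpa using hw.add hz⟩
  | smul c x _ hx =>
    obtain ⟨w, hw⟩ := hx
    exact ⟨c • w, by simpa using hw.smul c⟩

theorem exists_isBary_of_mem_convexHull (hx : x ∈ convexHull ℝ (F : Set E)) :
    ∃ w, IsBary F 1 w x := by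
  classical
  rw [Finset.convexHull_eq] at hx
  obtain ⟨w, -, hw, rfl⟩ := hx
  refine ⟨fun v => if v ∈ F then w v else 0, fun v hv => by simp [hv], ?_, ?_⟩
  · rw [← hw]
    exact Finset.sum_congr rfl fun v hv => by simp [hv]
  · rw [Finset.centerMass_eq_of_sum_1 _ _ hw]
    exact Finset.sum_congr rfl fun v hv => by simp [hv]

/-- The barycentric coordinates of a point of a simplex. -/
def baryPoint (x : Points F) : E → ℝ := (exists_isBary_of_mem_convexHull x.2).choose

theorem isBary_baryPoint (x : Points F) : IsBary F 1 (baryPoint x) x :=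
  (exists_isBary_of_mem_convexHull x.2).choose_spec

/-- The differentials of the barycentric coordinates of a simplex. -/
def baryTangent (hF : AffineIndependent ℝ ((↑) : F → E)) : Tangent F →ₗ[ℝ] (E → ℝ) where
  toFun x := (exists_isBary_of_mem_vectorSpan x.2).choose
  map_add' x y := by
    refine IsBary.unique hF (exists_isBary_of_mem_vectorSpan (x + y).2).choose_spec ?_
    simpa using (exists_isBary_of_mem_vectorSpan x.2).choose_spec.add
      (exists_isBary_of_mem_vectorSpan y.2).choose_spec
  map_smul' c x := by
    refine IsBary.unique hF (exists_isBary_of_mem_vectorSpan (c • x).2).choose_spec ?_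
    simpa using (exists_isBary_of_mem_vectorSpan x.2).choose_spec.smul c

theorem isBary_baryTangent (hF : AffineIndependent ℝ ((↑) : F → E)) (x : Tangent F) :
    IsBary F 0 (baryTangent hF x) x :=
  (exists_isBary_of_mem_vectorSpan x.2).choose_spec

/-- The pullback of a double form on `ℝ^K` to a simplex `F` under the map given by the barycentric
coordinates. -/
def baryPullback {p q : ℕ} (hF : AffineIndependent ℝ ((↑) : F → E)) (K : Finset E) :
    ((K → ℝ) → DoubleCovector p q (K → ℝ)) →ₗ[ℝ] FormOn p q F where
  toFun Ψ x := pullback (LinearMap.funLeft ℝ ℝ ((↑) : K → E) ∘ₗ baryTangent hF)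
    (Ψ fun k => baryPoint x k)
  map_add' _ _ := by ext; rfl
  map_smul' _ _ := by ext; rfl

theorem isBaryPullback_baryPullback {p q : ℕ} (hF : AffineIndependent ℝ ((↑) : F → E))
    (Ψ : (K → ℝ) → DoubleCovector p q (K → ℝ)) :
    IsBaryPullback K F Ψ (baryPullback hF K Ψ) := by
  intro x X Y w a b hw ha hb
  obtain rfl := hw.unique hF (isBary_baryPoint x)
  obtain rfl : a = fun j => baryTangent hF (X j) :=
    funext fun j => (ha j).unique hF (isBary_baryTangent hF _)
  obtain rfl : b = fun j => baryTangent hF (Y j) :=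
    funext fun j => (hb j).unique hF (isBary_baryTangent hF _)
  rfl

theorem IsBaryPullback.eq_baryPullback {p q : ℕ} (hF : AffineIndependent ℝ ((↑) : F → E))
    {Ψ : (K → ℝ) → DoubleCovector p q (K → ℝ)} {φ : FormOn p q F} (h : IsBaryPullback K F Ψ φ) :
    φ = baryPullback hF K Ψ := by
  ext x X Y
  exact h x X Y _ _ _ (isBary_baryPoint x) (fun _ => isBary_baryTangent hF _)
    fun _ => isBary_baryTangent hF _

/-- Coordinates on a face, extended by zero, are coordinates on `F`. Hence pullbacks of one `Ψ` to
all simplices are compatible with traces. -/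
theorem IsBaryPullback.trace {p q : ℕ} {G : Finset E} (h : G ⊆ F)
    {Ψ : (K → ℝ) → DoubleCovector p q (K → ℝ)} {φ : FormOn p q F} (hφ : IsBaryPullback K F Ψ φ) :
    IsBaryPullback K G Ψ (trace h φ) :=
  fun _ _ _ w a b hw ha hb => hφ _ _ _ w a b (hw.mono h) (fun j => (ha j).mono h)
    fun j => (hb j).mono h

theorem isPolyOn_of_isHomogeneous {r : ℕ} {P : MvPolynomial K ℝ} (hP : P.IsHomogeneous r)
    {f : Points F → ℝ}
    (hf : ∀ (x : Points F) (w : E → ℝ), IsBary F 1 w x →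
      f x = MvPolynomial.eval (fun k : K => w k) P) :
    IsPolyOn r F f := by
  classical
  let g (k : K) : MvPolynomial F ℝ := if h : (k : E) ∈ F then MvPolynomial.X ⟨k, h⟩ else 0
  refine ⟨MvPolynomial.aeval g P, ?_, fun x w hw => ?_⟩
  · refine (MvPolynomial.IsHomogeneous.totalDegree_le (n := r) ?_)
    rw [← one_mul r]
    refine hP.aeval _ fun k => ?_
    by_cases h : (k : E) ∈ F
    · simpa [g, h] using MvPolynomial.isHomogeneous_X ℝ _
    · simpa [g, h] using MvPolynomial.isHomogeneous_zero _ _ _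
  · rw [hf x w hw, MvPolynomial.aeval_def, MvPolynomial.eval_eval₂]
    have : ((MvPolynomial.eval fun v : F => w v).comp
        (algebraMap ℝ (MvPolynomial F ℝ))) = RingHom.id ℝ := by
      ext
      simp
    rw [this, MvPolynomial.eval₂_id]
    congr 2
    funext k
    by_cases h : (k : E) ∈ F
    · simp [g, h]
    · simp [g, h, hw.1 _ h]

theorem baryPullback_mem_polyForms {r p q m : ℕ} (hF : AffineIndependent ℝ ((↑) : F → E))
    {Ψ : (K → ℝ) → DoubleCovector p q (K → ℝ)} (hΨ : Ψ ∈ homFormsVanishing r p q m K) :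
    baryPullback hF K Ψ ∈ polyForms r p q m F := by
  refine ⟨fun X Y => ?_, fun x => pullback_mem_summand _ (hΨ.2.1 _)⟩
  obtain ⟨P, hP, hP'⟩ := hΨ.1 (fun j k => baryTangent hF (X j) k) fun j k => baryTangent hF (Y j) k
  refine isPolyOn_of_isHomogeneous hP fun x w hw => ?_
  rw [← hP']
  exact isBaryPullback_baryPullback hF Ψ x X Y w _ _ hw (fun _ => isBary_baryTangent hF _)
    fun _ => isBary_baryTangent hF _

/-- For `k ∈ K` outside `F`, the coordinate `λ_k` is zero on `F`, so `F` is mapped into a hyperplane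
on which `Ψ` has zero trace. -/
theorem baryPullback_eq_zero {r p q m : ℕ} (hF : AffineIndependent ℝ ((↑) : F → E))
    {Ψ : (K → ℝ) → DoubleCovector p q (K → ℝ)} (hΨ : Ψ ∈ homFormsVanishing r p q m K)
    (hKF : ¬ K ⊆ F) : baryPullback hF K Ψ = 0 := by
  obtain ⟨k, hK, hk⟩ := Finset.not_subset.1 hKF
  ext x X Y
  exact hΨ.2.2 ⟨k, hK⟩ _ _ _ ((isBary_baryPoint x).1 k hk)
    (fun j => (isBary_baryTangent hF _).1 k hk) fun j => (isBary_baryTangent hF _).1 k hk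

end Barycentric

/-! ### Lifting constant covectors from a simplex to coordinate space. -/

section Lift

open Function (update)

variable {E : Type*} [AddCommGroup E] [Module ℝ E] {K F : Finset E} {p q m : ℕ}

/-- The map from the tangent space of a simplex to `ℝ^K` given by the differentials of the
barycentric coordinates. -/
def baryDifferential (hF : AffineIndependent ℝ ((↑) : F → E)) (K : Finset E) :
    Tangent F →ₗ[ℝ] (K → ℝ) :=
  LinearMap.funLeft ℝ ℝ ((↑) : K → E) ∘ₗ baryTangent hF

/-- The difference of two vertices, as a tangent vector. -/
def edge (u v : K) : Tangent K :=
  ⟨(u : E) - v, vsub_mem_vectorSpan ℝ (Finset.mem_coe.2 u.2) (Finset.mem_coe.2 v.2)⟩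

theorem edge_sub_edge (u v o : K) : edge u o - edge v o = edge u v :=
  Subtype.ext (sub_sub_sub_cancel_right _ _ _)

/-- The projection of `ℝ^K` along the vertex `o` onto the tangent space of the simplex. -/
def coneProj (o : K) : (K → ℝ) →ₗ[ℝ] Tangent K :=
  ∑ v, (LinearMap.proj v).smulRight (edge v o)

theorem coneProj_apply (o : K) (x : K → ℝ) : coneProj o x = ∑ v, x v • edge v o := by
  simp [coneProj]

theorem coe_coneProj (o : K) (x : K → ℝ) :
    (coneProj o x : E) = ∑ v, x v • ((v : E) - o) := by
  simp [coneProj_apply, edge]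

theorem coneProj_single_sub_single [DecidableEq E] (o u v : K) :
    coneProj o (Pi.single u 1 - Pi.single v 1) = edge u v := by
  rw [coneProj_apply, ← edge_sub_edge u v o]
  simp [sub_smul, Finset.sum_sub_distrib, Pi.single_apply]

/-- Only edges `v - o` with `v ≠ i` occur, and `o ≠ i` puts both endpoints on the face opposite `i`.
-/
theorem coneProj_mem_vectorSpan [DecidableEq E] (o : K) {i : K} (hi : i ≠ o) {x : K → ℝ}
    (hx : x i = 0) : (coneProj o x : E) ∈ vectorSpan ℝ ((K.erase i : Finset E) : Set E) := by
  rw [coe_coneProj]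
  refine Submodule.sum_mem _ fun v _ => ?_
  rcases eq_or_ne v i with rfl | hv
  · simp [hx]
  · refine Submodule.smul_mem _ _ (vsub_mem_vectorSpan ℝ ?_ ?_)
    · exact Finset.mem_coe.2 (Finset.mem_erase.2 ⟨fun h => hv (Subtype.ext h), v.2⟩)
    · exact Finset.mem_coe.2 (Finset.mem_erase.2 ⟨fun h => hi (Subtype.ext h.symm), o.2⟩)

theorem sum_baryDifferential (hK : AffineIndependent ℝ ((↑) : K → E)) (x : Tangent K) :
    ∑ v, baryDifferential hK K x v = 0 := by
  rw [← (isBary_baryTangent hK x).2.1]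
  exact Finset.sum_coe_sort K (baryTangent hK x)

theorem coneProj_baryDifferential (hK : AffineIndependent ℝ ((↑) : K → E)) (o : K)
    (x : Tangent K) : coneProj o (baryDifferential hK K x) = x := by
  ext
  rw [coe_coneProj]
  simp only [smul_sub, Finset.sum_sub_distrib, ← Finset.sum_smul, sum_baryDifferential, zero_smul,
    sub_zero]
  rw [← (isBary_baryTangent hK x).2.2]
  exact Finset.sum_coe_sort K (fun v => baryTangent hK x v • v)

/-- A double covector on the tangent space of a simplex vanishes on the tangent space of the face
with vertex set `L`. -/
def VanishesOn (L : Finset E) (ψ : DoubleCovector p q (Tangent K)) : Prop :=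
  ∀ X Y, (∀ j, (X j : E) ∈ vectorSpan ℝ (L : Set E)) →
    (∀ j, (Y j : E) ∈ vectorSpan ℝ (L : Set E)) → ψ X Y = 0

theorem pullback_coneProj_eq_zero [DecidableEq E] {ψ : DoubleCovector p q (Tangent K)} {o i : K}
    (hi : i ≠ o) (h : VanishesOn (K.erase i) ψ) {X : Fin p → K → ℝ} {Y : Fin q → K → ℝ}
    (hX : ∀ j, X j i = 0) (hY : ∀ j, Y j i = 0) : pullback (coneProj o) ψ X Y = 0 :=
  h _ _ (fun j => coneProj_mem_vectorSpan o hi (hX j)) fun j => coneProj_mem_vectorSpan o hi (hY j)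

theorem pullback_baryDifferential_pullback_coneProj (hK : AffineIndependent ℝ ((↑) : K → E))
    (o : K) (ψ : DoubleCovector p q (Tangent K)) :
    pullback (baryDifferential hK K) (pullback (coneProj o) ψ) = ψ := by
  ext X Y
  simp [pullback_apply, coneProj_baryDifferential]

/-- The symmetrization of a bilinear form, expressed by its values on the edges of a simplex. -/
theorem sum_edge_edge (hK : AffineIndependent ℝ ((↑) : K → E))
    (B : Tangent K →ₗ[ℝ] Tangent K →ₗ[ℝ] ℝ) (x y : Tangent K) :
    ∑ i, ∑ j, (baryDifferential hK K x i * baryDifferential hK K y j +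
        baryDifferential hK K x j * baryDifferential hK K y i) * B (edge i j) (edge i j) =
      -2 * (B x y + B y x) := by
  rcases isEmpty_or_nonempty K with h | ⟨⟨o⟩⟩
  · have hx (x : Tangent K) : x = 0 := by
      rw [← Subtype.coe_inj, ← (isBary_baryTangent hK x).2.2]
      rw [← Finset.sum_coe_sort K (fun v => baryTangent hK x v • v)]
      simp
    simp [hx x]
  · set s := baryDifferential hK K x with hs
    set t := baryDifferential hK K y with ht
    have hx : x = ∑ i, s i • edge i o := by
      rw [← coneProj_apply, hs, coneProj_baryDifferential]
    have hy : y = ∑ i, t i • edge i o := by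
      rw [← coneProj_apply, ht, coneProj_baryDifferential]
    have hs0 : ∑ i, s i = 0 := sum_baryDifferential hK x
    have ht0 : ∑ i, t i = 0 := sum_baryDifferential hK y
    have key (s t : K → ℝ) (hs0 : ∑ i, s i = 0) (ht0 : ∑ i, t i = 0) :
        ∑ i, ∑ j, s i * t j * B (edge i j) (edge i j) =
        - (B (∑ i, s i • edge i o) (∑ i, t i • edge i o) +
          B (∑ i, t i • edge i o) (∑ i, s i • edge i o)) := by
      -- Expand `edge i j = edge i o - edge j o`. The terms involving `B` at only one endpoint drop
      -- out because `s` and `t` have sum zero.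
      have e (i j : K) : s i * t j * B (edge i j) (edge i j) =
          t j * (s i * B (edge i o) (edge i o)) - s i * t j * B (edge i o) (edge j o)
          - t j * s i * B (edge j o) (edge i o) + s i * (t j * B (edge j o) (edge j o)) := by
        rw [← edge_sub_edge i j o]
        simp only [map_sub, LinearMap.sub_apply]
        ring
      simp only [e, Finset.sum_add_distrib, Finset.sum_sub_distrib]
      rw [← Finset.sum_mul_sum _ _ s, hs0]
      rw [Finset.sum_comm (f := fun i j => t j * (s i * B (edge i o) (edge i o))),
        ← Finset.sum_mul_sum _ _ t, ht0]
      simp only [map_sum, LinearMap.sum_apply, map_smul, LinearMap.smul_apply, smul_eq_mul,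
        Finset.mul_sum]
      rw [Finset.sum_comm (f := fun i j => t j * s i * B (edge j o) (edge i o)),
        Finset.sum_comm (f := fun i j => t i * (s j * B (edge j o) (edge i o)))]
      rw [Finset.sum_comm (f := fun i j => s i * (t j * B (edge j o) (edge i o)))]
      simp only [mul_assoc]
      simp only [mul_left_comm (t _) (s _), zero_mul, Finset.sum_const_zero]
      ring
    have h2 (i j : K) : (s i * t j + s j * t i) * B (edge i j) (edge i j) =
        s i * t j * B (edge i j) (edge i j) + t i * s j * B (edge i j) (edge i j) := by ring
    simp only [h2, Finset.sum_add_distrib, key s t hs0 ht0, key t s ht0 hs0, ← hx, ← hy]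
    ring

theorem comp_update {V W : Type*} {n : ℕ} (f : V → W) (X : Fin n → V) (a : Fin n) (v : V) :
    (fun i => f (update X a v i)) = update (fun i => f (X i)) a (f v) :=
  funext fun i => Function.apply_update (fun _ => f) X a v i

/-- The restriction of the sum over the edges of a simplex of the products of
`dλᵢ ⊗ dλⱼ + dλⱼ ⊗ dλᵢ` with the contractions with the edge. -/
theorem sum_symmSubstitute [DecidableEq E] (hK : AffineIndependent ℝ ((↑) : K → E))
    (ψ : DoubleCovector (p + 1) (q + 1) (Tangent K)) (X : Fin (p + 1) → Tangent K)
    (Y : Fin (q + 1) → Tangent K) :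
    ∑ i : K, ∑ j : K, symmSubstitute (LinearMap.proj i) (LinearMap.proj j)
        (Pi.single i 1 - Pi.single j 1) (pullback (coneProj i) ψ)
        (fun k => baryDifferential hK K (X k)) (fun k => baryDifferential hK K (Y k)) =
      -2 * ((p + 1) * (q + 1) * ψ X Y + swapSum ψ X Y) := by
  let B (a : Fin (p + 1)) (b : Fin (q + 1)) : Tangent K →ₗ[ℝ] Tangent K →ₗ[ℝ] ℝ :=
    LinearMap.mk₂ ℝ (fun u w => ψ (update X a u) (update Y b w))
      (by simp) (by simp) (by simp) (by simp)
  have hB (a b u w) : B a b u w = ψ (update X a u) (update Y b w) := rfl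
  simp only [symmSubstitute_apply, pullback_apply, comp_update, coneProj_single_sub_single,
    coneProj_baryDifferential, LinearMap.proj_apply, ← hB]
  calc _ = ∑ a, ∑ b, ∑ i, ∑ j,
        (baryDifferential hK K (X a) i * baryDifferential hK K (Y b) j +
        baryDifferential hK K (X a) j * baryDifferential hK K (Y b) i) *
          B a b (edge i j) (edge i j) := by
        simp only [Finset.sum_comm (s := (Finset.univ : Finset K))
          (t := (Finset.univ : Finset (Fin (p + 1)))),
          Finset.sum_comm (s := (Finset.univ : Finset K))
          (t := (Finset.univ : Finset (Fin (q + 1))))]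
    _ = _ := by
      simp only [sum_edge_edge, ← Finset.mul_sum, Finset.sum_add_distrib]
      simp [hB, swapSum, mul_assoc]

theorem exists_lift_constant [DecidableEq E] (hK : AffineIndependent ℝ ((↑) : K → E)) (hmq : m < q)
    {ψ : DoubleCovector p q (Tangent K)} (hψ : ψ ∈ summand p q m (Tangent K))
    (hv : ∀ i : K, (∃ j, j ≠ i) → VanishesOn (K.erase i) ψ) :
    ∃ Ψ ∈ summand p q m (K → ℝ), (∀ (i : K) (X : Fin p → K → ℝ) (Y : Fin q → K → ℝ),
      (∀ j, X j i = 0) → (∀ j, Y j i = 0) → Ψ X Y = 0) ∧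
      pullback (baryDifferential hK K) Ψ = ψ := by
  -- This number is `pq` plus the eigenvalue `q - m (m + p - q + 1)` of `swapSum`.
  have hc : (0 : ℝ) < (q - m) * (m + p + 1) :=
    mul_pos (sub_pos.2 (by exact_mod_cast hmq)) (by positivity)
  cases q with
  | zero => omega
  | succ q =>
  cases p with
  | zero =>
    -- For `p = 0` the swap sum is empty, so the eigenvalue equation forces `ψ = 0`.
    refine ⟨0, Submodule.zero_mem _, fun _ _ _ _ _ => rfl, ?_⟩
    ext X Y
    have h := mem_summand_iff.1 hψ X Y
    rw [swapSum, Finset.univ_eq_empty, Finset.sum_empty, eq_comm] at h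
    push_cast at h hc
    refine ((mul_eq_zero.1 h).resolve_left ?_).symm
    nlinarith
  | succ p =>
    push_cast at hc
    refine ⟨(-2 * ((q + 1 - m) * (m + (p + 1) + 1)) : ℝ)⁻¹ • ∑ i : K, ∑ j : K,
      symmSubstitute (LinearMap.proj i) (LinearMap.proj j)
        (Pi.single i 1 - Pi.single j 1) (pullback (coneProj i) ψ), ?_, ?_, ?_⟩
    · exact Submodule.smul_mem _ _ (Submodule.sum_mem _ fun i _ => Submodule.sum_mem _ fun j _ =>
        symmSubstitute_mem_summand _ _ _ (pullback_mem_summand _ hψ))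
    · intro k X Y hX hY
      simp only [AlternatingMap.smul_apply, alternatingMap_sum_apply]
      rw [Finset.sum_eq_zero fun i _ => Finset.sum_eq_zero fun j _ => ?_, smul_zero]
      rw [symmSubstitute_apply]
      refine Finset.sum_eq_zero fun a _ => Finset.sum_eq_zero fun b _ => ?_
      -- If `k` is an endpoint, `dλ_k` occurs in each product and kills the term. Otherwise the edge
      -- vector has zero `k`-th coordinate, and `i ≠ k` allows use of the vanishing on the face
      -- opposite `k`.
      rcases eq_or_ne i k with rfl | hi
      · simp [hX, hY]
      rcases eq_or_ne j k with rfl | hj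
      · simp [hX, hY]
      have hu {n : ℕ} (Z : Fin n → K → ℝ) (hZ : ∀ j, Z j k = 0) (a l : Fin n) :
          update Z a (Pi.single i 1 - Pi.single j 1) l k = 0 := by
        rcases eq_or_ne l a with rfl | hl
        · simp [hi.symm, hj.symm]
        · simp [hl, hZ]
      rw [pullback_coneProj_eq_zero hi.symm (hv k ⟨i, hi⟩) (hu X hX a) (hu Y hY b), mul_zero]
    · ext X Y
      rw [map_smul, AlternatingMap.smul_apply, AlternatingMap.smul_apply, pullback_apply]
      simp only [alternatingMap_sum_apply]
      rw [sum_symmSubstitute, mem_summand_iff.1 hψ, smul_eq_mul, inv_mul_eq_iff_eq_mul₀ (by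
        intro h; linarith)]
      push_cast
      ring

end Lift

/-! ### Coefficients of polynomial forms and the homogeneous lift. -/

section Coefficients

open MvPolynomial

variable {E : Type*} [AddCommGroup E] [Module ℝ E] {K L : Finset E} {p q m r : ℕ}

/-- Setting the variables outside `s` to zero leaves the part `Q` of `P` with monomials supported in
`s`; it vanishes on a product of infinite sets, hence identically. -/
theorem coeff_eq_zero_of_eval_eq_zero {σ : Type*} [Fintype σ] (s : Set σ)
    {P : MvPolynomial σ ℝ}
    (h : ∀ w : σ → ℝ, (∀ i ∈ s, 0 < w i) → (∀ i ∉ s, w i = 0) → eval w P = 0)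
    {d : σ →₀ ℕ} (hd : ∀ i ∉ s, d i = 0) : coeff d P = 0 := by
  classical
  let Q : MvPolynomial σ ℝ :=
    ∑ e ∈ P.support with ∀ i ∉ s, e i = 0, monomial e (coeff e P)
  have hQ : Q = 0 := by
    refine MvPolynomial.funext_set (fun _ => Set.Ioi (0 : ℝ)) (fun _ => Set.Ioi_infinite _)
      fun w hw => ?_
    rw [map_zero, ← h (fun i => if i ∈ s then w i else 0)
      (fun i hi => by simpa [hi] using hw i (Set.mem_univ i)) (fun i hi => by simp [hi])]
    rw [eval_eq' _ P, map_sum, Finset.sum_filter]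
    refine Finset.sum_congr rfl fun e _ => ?_
    split_ifs with he
    · rw [eval_monomial, Finsupp.prod_fintype _ _ (by simp)]
      congr 1
      refine Finset.prod_congr rfl fun i _ => ?_
      by_cases hi : i ∈ s
      · simp [hi]
      · simp [he i hi]
    · push Not at he
      obtain ⟨i, hi, hei⟩ := he
      rw [Finset.prod_eq_zero (Finset.mem_univ i), mul_zero]
      simp [hi, hei]
  have hc : coeff d Q = coeff d P := by
    simp only [Q, coeff_sum, coeff_monomial]
    rw [Finset.sum_ite_eq']
    split_ifs with h'
    · rfl
    · have : d ∉ P.support := fun hP => h' (Finset.mem_filter.2 ⟨hP, hd⟩)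
      exact (notMem_support_iff.1 this).symm
  rw [← hc, hQ, coeff_zero]

theorem eval_smul_of_isHomogeneous {σ : Type*} [Fintype σ] {P : MvPolynomial σ ℝ}
    (hP : P.IsHomogeneous r) (a : ℝ) (w : σ → ℝ) : eval (a • w) P = a ^ r * eval w P := by
  rw [eval_eq', eval_eq', Finset.mul_sum]
  refine Finset.sum_congr rfl fun d hd => ?_
  have h : ∑ i, d i = r := by
    rw [← Finsupp.degree_eq_sum, Finsupp.degree_eq_weight_one]
    exact hP (mem_support_iff.1 hd)
  simp only [Pi.smul_apply, smul_eq_mul, mul_pow, Finset.prod_mul_distrib,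
    Finset.prod_pow_eq_pow_sum, h]
  ring

/-- The evaluation of a polynomial at the barycentric coordinates of the points of a simplex. -/
def evalBary (K : Finset E) : MvPolynomial K ℝ →ₗ[ℝ] (Points K → ℝ) :=
  LinearMap.pi fun x => (MvPolynomial.aeval fun k : K => baryPoint x k).toLinearMap

theorem evalBary_apply (P : MvPolynomial K ℝ) (x : Points K) :
    evalBary K P x = eval (fun k : K => baryPoint x k) P := by
  simp [evalBary, aeval_eq_eval]

/-- By homogeneity, vanishing on the face `L` extends by scaling to the open positive cone over it.
-/
theorem coeff_eq_zero_of_evalBary (hK : AffineIndependent ℝ ((↑) : K → E)) (hLK : L ⊆ K)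
    (hL : L.Nonempty) {P : MvPolynomial K ℝ} (hP : P.IsHomogeneous r)
    (h : ∀ x : Points K, (x : E) ∈ convexHull ℝ (L : Set E) → evalBary K P x = 0)
    {d : K →₀ ℕ} (hd : ∀ i : K, (i : E) ∉ L → d i = 0) : coeff d P = 0 := by
  classical
  refine coeff_eq_zero_of_eval_eq_zero {i : K | (i : E) ∈ L} (fun w hw hw' => ?_) hd
  let u (v : E) : ℝ := if hv : v ∈ K then w ⟨v, hv⟩ else 0
  have huK (k : K) : u k = w k := by simp [u]
  have hu (v) (hv : v ∈ L) : 0 < u v := by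
    simpa [u, hLK hv] using hw ⟨v, hLK hv⟩ hv
  have hu' (v) (hv : v ∉ L) : u v = 0 := by
    by_cases hvK : v ∈ K
    · simpa [u, hvK] using hw' ⟨v, hvK⟩ hv
    · simp [u, hvK]
  set s := ∑ v ∈ L, u v with hs
  have hs0 : 0 < s := Finset.sum_pos hu hL
  have hx : ∑ v ∈ L, (s⁻¹ • u) v • v ∈ convexHull ℝ (L : Set E) := by
    refine (convex_convexHull ℝ _).sum_mem (fun v hv => ?_) ?_
      fun v hv => subset_convexHull ℝ _ hv
    · exact mul_nonneg (inv_nonneg.2 hs0.le) (hu v hv).le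
    · simp [← Finset.mul_sum, ← hs, hs0.ne']
  have hb : IsBary K 1 (s⁻¹ • u) (∑ v ∈ L, (s⁻¹ • u) v • v) := by
    refine IsBary.mono (K := L) ⟨fun v hv => by simp [hu' v hv], ?_, rfl⟩ hLK
    simp [← Finset.mul_sum, ← hs, hs0.ne']
  have h0 := h ⟨_, convexHull_mono (Finset.coe_subset.2 hLK) hx⟩ hx
  rw [evalBary_apply, (isBary_baryPoint _).unique hK hb] at h0
  have hw'' : w = s • fun k : K => (s⁻¹ • u) k := by
    funext k
    simp [huK, hs0.ne']
  rw [hw'', eval_smul_of_isHomogeneous hP, h0, mul_zero]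

/-- A polynomial function of degree at most `r` on a simplex is a homogeneous polynomial of degree
`r` in the barycentric coordinates. -/
theorem IsPolyOn.exists_isHomogeneous {f : Points K → ℝ} (hf : IsPolyOn r K f) :
    ∃ P : MvPolynomial K ℝ, P.IsHomogeneous r ∧ evalBary K P = f := by
  obtain ⟨P, hP, hf⟩ := hf
  -- Homogenize with powers of `∑ λ_v`, which is `1` on the simplex.
  refine ⟨∑ k ∈ Finset.range (P.totalDegree + 1),
    (∑ v : K, X v) ^ (r - k) * homogeneousComponent k P, ?_, ?_⟩
  · refine IsHomogeneous.sum _ _ _ fun k hk => ?_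
    have hk' : k ≤ r := (Nat.lt_succ_iff.1 (Finset.mem_range.1 hk)).trans hP
    have h1 : (∑ v : K, (X v : MvPolynomial K ℝ)).IsHomogeneous 1 :=
      IsHomogeneous.sum _ _ _ fun v _ => isHomogeneous_X _ _
    have := (h1.pow (r - k)).mul (homogeneousComponent_isHomogeneous k P)
    rwa [one_mul, Nat.sub_add_cancel hk'] at this
  · funext x
    have h1 : ∑ v : K, baryPoint x v = 1 := by
      rw [← (isBary_baryPoint x).2.1]
      exact Finset.sum_coe_sort K (baryPoint x)
    rw [hf x _ (isBary_baryPoint x), evalBary_apply]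
    conv_rhs => rw [← sum_homogeneousComponent P]
    simp [-Finset.univ_eq_attach, h1]

/-- Functionals defined on all functions let coefficients be extracted linearly, so `mapForm` yields
covectors and preserves the eigenvalue equation. -/
theorem exists_coeff_functional (hK : AffineIndependent ℝ ((↑) : K → E)) (hK' : K.Nonempty)
    (r : ℕ) : ∃ c : (K →₀ ℕ) → (Points K → ℝ) →ₗ[ℝ] ℝ,
      ∀ P : MvPolynomial K ℝ, P.IsHomogeneous r → ∀ d, c d (evalBary K P) = coeff d P := by
  let f := evalBary K ∘ₗ (homogeneousSubmodule K ℝ r).subtype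
  have hf : LinearMap.ker f = ⊥ := by
    rw [LinearMap.ker_eq_bot']
    rintro ⟨P, hP⟩ h
    ext d
    refine coeff_eq_zero_of_evalBary hK subset_rfl hK' hP (fun x _ => congr_fun h x) ?_
    exact fun i hi => absurd i.2 hi
  obtain ⟨g, hg⟩ := f.exists_leftInverse_of_injective hf
  refine ⟨fun d => lcoeff ℝ d ∘ₗ (homogeneousSubmodule K ℝ r).subtype ∘ₗ g, fun P hP d => ?_⟩
  have : g (evalBary K P) = ⟨P, hP⟩ := LinearMap.congr_fun hg ⟨P, hP⟩
  simp [this]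

/-- The double covector obtained from a double form by applying a linear functional to its
coefficients. -/
def mapForm (c : (Points K → ℝ) →ₗ[ℝ] ℝ) (φ : FormOn p q K) : DoubleCovector p q (Tangent K) where
  toFun X :=
    { toFun := fun Y => c fun x => φ x X Y
      map_update_add' := fun Y i u v => by
        rw [← map_add]
        congr 1
        ext x
        simp
      map_update_smul' := fun Y i a v => by
        rw [← map_smul]
        congr 1
        ext x
        simp
      map_eq_zero_of_eq' := fun Y i j h hij => by
        rw [← map_zero c]
        congr 1
        ext x
        exact AlternatingMap.map_eq_zero_of_eq _ _ h hij }
  map_update_add' X i u v := by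
    ext Y
    refine (congrArg c ?_).trans (map_add c _ _)
    ext x
    simp
  map_update_smul' X i a v := by
    ext Y
    refine (congrArg c ?_).trans (map_smul c _ _)
    ext x
    simp
  map_eq_zero_of_eq' X i j h hij := by
    ext Y
    refine (congrArg c ?_).trans (map_zero c)
    ext x
    rw [AlternatingMap.map_eq_zero_of_eq _ _ h hij]
    rfl

theorem mapForm_apply (c : (Points K → ℝ) →ₗ[ℝ] ℝ) (φ : FormOn p q K) (X : Fin p → Tangent K)
    (Y : Fin q → Tangent K) : mapForm c φ X Y = c fun x => φ x X Y := rfl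

theorem mapForm_mem_summand (c : (Points K → ℝ) →ₗ[ℝ] ℝ) {φ : FormOn p q K}
    (hφ : ∀ x, φ x ∈ summand p q m (Tangent K)) : mapForm c φ ∈ summand p q m (Tangent K) := by
  rw [mem_summand_iff]
  intro X Y
  simp only [swapSum, mapForm_apply, ← map_sum]
  rw [← smul_eq_mul, ← map_smul]
  congr 1
  ext x
  simpa [swapSum] using mem_summand_iff.1 (hφ x) X Y

theorem exists_homogeneous_lift [DecidableEq E] (hK : AffineIndependent ℝ ((↑) : K → E))
    (hK' : K.Nonempty) (hmq : m ≤ q) (hrm : (r, m) ≠ (0, q)) {φ : FormOn p q K}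
    (hφ : φ ∈ polyFormsVanishing r p q m K) :
    ∃ Ψ ∈ homFormsVanishing r p q m K, baryPullback hK K Ψ = φ := by
  obtain ⟨hφ, hφ'⟩ := Submodule.mem_inf.1 hφ
  obtain ⟨c, hc⟩ := exists_coeff_functional hK hK' r
  have hsum (d : K →₀ ℕ) : mapForm (c d) φ ∈ summand p q m (Tangent K) :=
    mapForm_mem_summand _ hφ.2
  -- A second vertex is required so that the face opposite `i` has points; an empty face gives no
  -- information on coefficients.
  have hvan (d : K →₀ ℕ) (i : K) (hi : ∃ j, j ≠ i) (hd : d i = 0) :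
      VanishesOn (K.erase i) (mapForm (c d) φ) := by
    obtain ⟨j, hj⟩ := hi
    have hss : K.erase i ⊂ K := Finset.erase_ssubset i.2
    have htr : trace hss.subset φ = 0 := by
      simp only [Submodule.mem_iInf] at hφ'
      exact hφ' _ hss
    intro X Y hX hY
    obtain ⟨P, hP, hP'⟩ := (hφ.1 X Y).exists_isHomogeneous
    rw [mapForm_apply, ← hP', hc P hP]
    refine coeff_eq_zero_of_evalBary hK hss.subset
      ⟨j, Finset.mem_erase.2 ⟨fun h => hj (Subtype.ext h), j.2⟩⟩ hP (fun x hx => ?_) fun k hk => ?_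
    · rw [hP']
      exact congr($htr ⟨x, hx⟩ (fun j => ⟨X j, hX j⟩) fun j => ⟨Y j, hY j⟩)
    · have : k = i := by
        by_contra h
        exact hk (Finset.mem_erase.2 ⟨fun h' => h (Subtype.ext h'), k.2⟩)
      rw [this, hd]
  have hlift (d : K →₀ ℕ) (hd : d.degree = r) : ∃ Ψ ∈ summand p q m (K → ℝ),
      (∀ (i : K) (X : Fin p → K → ℝ) (Y : Fin q → K → ℝ), d i = 0 →
        (∀ j, X j i = 0) → (∀ j, Y j i = 0) → Ψ X Y = 0) ∧
      pullback (baryDifferential hK K) Ψ = mapForm (c d) φ := by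
    rcases eq_or_ne d 0 with rfl | hd0
    · have hr : r = 0 := by simpa using hd.symm
      have hlt : m < q := lt_of_le_of_ne hmq fun h => hrm (by rw [hr, h])
      obtain ⟨Ψ, h1, h2, h3⟩ := exists_lift_constant hK hlt (hsum 0) fun i hi => hvan 0 i hi rfl
      exact ⟨Ψ, h1, fun i X Y _ => h2 i X Y, h3⟩
    · obtain ⟨o, ho⟩ := Finsupp.ne_iff.1 hd0
      refine ⟨pullback (coneProj o) (mapForm (c d) φ), pullback_mem_summand _ (hsum d),
        fun i X Y hi hX hY => ?_, pullback_baryDifferential_pullback_coneProj hK o _⟩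
      have hio : i ≠ o := by
        rintro rfl
        exact ho hi
      exact pullback_coneProj_eq_zero hio (hvan d i ⟨o, hio.symm⟩ hi) hX hY
  choose! Ψ hΨ using hlift
  have hS (d : K →₀ ℕ) (hd : d ∈ Finset.finsuppAntidiag (Finset.univ : Finset K) r) :
      d.degree = r := by
    rw [Finsupp.degree_eq_sum]
    exact (Finset.mem_finsuppAntidiag.1 hd).1
  refine ⟨fun w => ∑ d ∈ Finset.finsuppAntidiag (Finset.univ : Finset K) r,
    (∏ k, w k ^ d k) • Ψ d, ⟨fun X Y => ?_, fun w => ?_, fun i w X Y hw hX hY => ?_⟩, ?_⟩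
  · refine ⟨∑ d ∈ Finset.finsuppAntidiag (Finset.univ : Finset K) r, monomial d (Ψ d X Y),
      IsHomogeneous.sum _ _ _ fun d hd => isHomogeneous_monomial _ (hS d hd), fun w => ?_⟩
    simp only [map_sum, alternatingMap_sum_apply]
    refine Finset.sum_congr rfl fun d _ => ?_
    rw [eval_monomial, Finsupp.prod_fintype _ _ (by simp)]
    simp [mul_comm]
  · exact Submodule.sum_mem _ fun d hd => Submodule.smul_mem _ _ (hΨ d (hS d hd)).1
  · simp only [alternatingMap_sum_apply]
    refine Finset.sum_eq_zero fun d hd => ?_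
    by_cases hdi : d i = 0
    · simp [(hΨ d (hS d hd)).2.1 i X Y hdi hX hY]
    · rw [Finset.prod_eq_zero (Finset.mem_univ i) (by simp [hw, hdi])]
      simp
  · ext x X Y
    obtain ⟨P, hP, hP'⟩ := (hφ.1 X Y).exists_isHomogeneous
    have hx : φ x X Y = eval (fun k : K => baryPoint x k) P := by
      rw [← evalBary_apply, hP']
    have hcoeff (d : K →₀ ℕ) (hd : d.degree = r) :
        pullback (baryDifferential hK K) (Ψ d) X Y = coeff d P := by
      rw [(hΨ d hd).2.2, mapForm_apply, ← hP', hc P hP]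
    rw [hx, eval_eq']
    change pullback (baryDifferential hK K) (∑ d ∈ _, (_ : ℝ) • Ψ d) X Y = _
    simp only [map_sum, alternatingMap_sum_apply]
    symm
    refine (Finset.sum_subset (fun d hd => ?_) fun d _ hd => ?_).trans
      (Finset.sum_congr rfl fun d hd => ?_)
    · rw [Finset.mem_finsuppAntidiag]
      refine ⟨?_, Finset.subset_univ _⟩
      rw [← Finsupp.degree_eq_sum, Finsupp.degree_eq_weight_one]
      exact hP (mem_support_iff.1 hd)
    · rw [notMem_support_iff.1 hd, zero_mul]
    · rw [← hcoeff d (hS d hd)]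
      simp [mul_comm]

end Coefficients

/-! ### Extension operators and the geometric decomposition. -/

section Decomposition

variable {E : Type*} [AddCommGroup E] [Module ℝ E] {T : Geometry.SimplicialComplex ℝ E}
  {r p q m : ℕ}

local instance addCommGroupForms {F : Finset E} (S : Submodule ℝ (FormOn p q F)) : AddCommGroup S :=
  Module.addCommMonoidToAddCommGroup ℝ

local instance addCommGroupGlobalForms : AddCommGroup (globalForms T r p q m) :=
  Module.addCommMonoidToAddCommGroup ℝ

/-- The extension of homogeneous double forms on `ℝ^K` to a simplicial complex, by the pullback
under the barycentric coordinates. -/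
def simplicialExtension (T : Geometry.SimplicialComplex ℝ E) (r p q m : ℕ) (K : T.faces) :
    homFormsVanishing r p q m K.1 →ₗ[ℝ] globalForms T r p q m where
  toFun Ψ := ⟨fun F => baryPullback (T.indep F.2) K.1 Ψ.1,
    fun F => baryPullback_mem_polyForms (T.indep F.2) Ψ.2,
    fun G F h => ((isBaryPullback_baryPullback (T.indep F.2) Ψ.1).trace h).eq_baryPullback
      (T.indep G.2)⟩
  map_add' Ψ Φ := by
    ext F : 2
    exact map_add (baryPullback (T.indep F.2) K.1) Ψ.1 Φ.1
  map_smul' c Ψ := by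
    ext F : 2
    exact map_smul (baryPullback (T.indep F.2) K.1) c Ψ.1

theorem exists_simplicial_local_extension [DecidableEq E] (T : Geometry.SimplicialComplex ℝ E)
    (hmq : m ≤ q) (hrm : (r, m) ≠ (0, q)) :
    ∃ (S : ∀ K : T.faces, polyFormsVanishing r p q m K.1 →ₗ[ℝ] homFormsVanishing r p q m K.1)
      (ext : ∀ K : T.faces, polyFormsVanishing r p q m K.1 →ₗ[ℝ] globalForms T r p q m),
      IsLocalExtension ext ∧
      ∀ (K F : T.faces) (φ : polyFormsVanishing r p q m K.1),
        IsBaryPullback K.1 F.1 (S K φ).1 (globalTrace F (ext K φ)).1 := by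
  have hS (K : T.faces) :
      ∃ S : polyFormsVanishing r p q m K.1 →ₗ[ℝ] homFormsVanishing r p q m K.1,
        ∀ φ, baryPullback (T.indep K.2) K.1 (S φ).1 = φ.1 := by
    let f := baryPullback (T.indep K.2) K.1 ∘ₗ (homFormsVanishing r p q m K.1).subtype
    have hf (φ : polyFormsVanishing r p q m K.1) : φ.1 ∈ LinearMap.range f := by
      obtain ⟨Ψ, hΨ, h⟩ := exists_homogeneous_lift (T.indep K.2) (T.nonempty_of_mem_faces K.2)
        hmq hrm φ.2
      exact ⟨⟨Ψ, hΨ⟩, h⟩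
    -- Lifts exist form by form; projectivity of a real vector space makes their choice linear.
    have : Module.Free ℝ (polyFormsVanishing r p q m K.1) := Module.Free.of_divisionRing ℝ _
    have : Module.Projective ℝ (polyFormsVanishing r p q m K.1) := Module.Projective.of_free
    obtain ⟨S, hS⟩ := Module.projective_lifting_property f.rangeRestrict
      (LinearMap.codRestrict _ (polyFormsVanishing r p q m K.1).subtype hf)
      f.surjective_rangeRestrict
    exact ⟨S, fun φ => congr(($hS φ).1)⟩
  choose S hS using hS
  refine ⟨S, fun K => simplicialExtension T r p q m K ∘ₗ S K, ⟨hS, fun K F h => ?_⟩,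
    fun K F φ => isBaryPullback_baryPullback (T.indep F.2) _⟩
  ext φ : 2
  exact baryPullback_eq_zero (T.indep F.2) (S K φ).2 h

variable {ext : ∀ K : T.faces, polyFormsVanishing r p q m K.1 →ₗ[ℝ] globalForms T r p q m}

/-- The empty set counts as a proper face in `polyFormsVanishing` but is not in `T.faces`; it has no
points. -/
theorem trace_eq_zero_of_empty {F : Finset E} (h : ∅ ⊆ F) (φ : FormOn p q F) :
    trace h φ = 0 := by
  funext x
  have hx := x.2
  simp at hx

theorem IsLocalExtension.globalTrace_apply (hext : IsLocalExtension ext) {K F : T.faces}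
    (h : ¬ K.1 ⊆ F.1) (φ : polyFormsVanishing r p q m K.1) : globalTrace F (ext K φ) = 0 :=
  LinearMap.congr_fun (hext.trace_eq_zero K F h) φ

theorem globalForms_ext {φ ψ : globalForms T r p q m}
    (h : ∀ F, globalTrace F φ = globalTrace F ψ) : φ = ψ :=
  Subtype.ext (funext fun F => congrArg Subtype.val (h F))

theorem globalTrace_mem_polyFormsVanishing {φ : globalForms T r p q m} {F : T.faces}
    (h : ∀ G : T.faces, G.1 ⊂ F.1 → globalTrace G φ = 0) :
    (globalTrace F φ).1 ∈ polyFormsVanishing r p q m F.1 := by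
  refine Submodule.mem_inf.2 ⟨(globalTrace F φ).2, ?_⟩
  simp only [Submodule.mem_iInf, LinearMap.mem_ker]
  intro G hG
  rcases G.eq_empty_or_nonempty with rfl | hG'
  · exact trace_eq_zero_of_empty _ _
  · let G' : T.faces := ⟨G, T.down_closed F.2 hG.subset hG'⟩
    exact (φ.2.2 G' F hG.subset).trans congr(($(h G' hG)).1)

/-- The sum of the extensions of a family of forms with vanishing trace. -/
def sumExtension [Fintype T.faces]
    (ext : ∀ K : T.faces, polyFormsVanishing r p q m K.1 →ₗ[ℝ] globalForms T r p q m) :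
    (∀ F : T.faces, polyFormsVanishing r p q m F.1) →ₗ[ℝ] globalForms T r p q m :=
  ∑ F, ext F ∘ₗ LinearMap.proj F

theorem sumExtension_apply [Fintype T.faces] (u : ∀ F : T.faces, polyFormsVanishing r p q m F.1) :
    sumExtension ext u = ∑ F, ext F (u F) := by
  simp [sumExtension]

/-- The triangularity: summands from simplices not contained in `F` vanish by locality, those from
proper faces by `hu`. -/
theorem IsLocalExtension.globalTrace_sumExtension [Fintype T.faces] (hext : IsLocalExtension ext)
    {u : ∀ F : T.faces, polyFormsVanishing r p q m F.1} {F : T.faces}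
    (hu : ∀ G : T.faces, G.1 ⊂ F.1 → u G = 0) :
    (globalTrace F (sumExtension ext u)).1 = (u F).1 := by
  rw [sumExtension_apply, map_sum, Finset.sum_eq_single F, hext.trace_self]
  · intro G _ hGF
    by_cases h : G.1 ⊆ F.1
    · rw [hu G (h.ssubset_of_ne fun h' => hGF (Subtype.ext h')), map_zero, map_zero]
    · exact hext.globalTrace_apply h _
  · simp

theorem IsLocalExtension.sumExtension_injective [Fintype T.faces] (hext : IsLocalExtension ext) :
    Function.Injective (sumExtension ext) := by
  rw [injective_iff_map_eq_zero]
  intro u hu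
  have h (n : ℕ) : ∀ F : T.faces, F.1.card = n → u F = 0 := by
    induction n using Nat.strong_induction_on with
    | _ n ih =>
      intro F hF
      have := hext.globalTrace_sumExtension (u := u) (F := F) fun G hG =>
        ih _ (hF ▸ Finset.card_lt_card hG) G rfl
      rw [hu, map_zero] at this
      exact Subtype.ext this.symm
  exact funext fun F => h _ F rfl

/-- Induct on the number of vertices. Once the remainder vanishes on simplices with fewer than `n`
vertices, its components on those with `n` vertices have zero boundary trace, and subtracting their
extensions leaves the smaller simplices unaffected. -/
theorem IsLocalExtension.sumExtension_surjective [Fintype T.faces] (hext : IsLocalExtension ext) :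
    Function.Surjective (sumExtension ext) := by
  intro φ
  have h (n : ℕ) : ∃ u, ∀ F : T.faces, F.1.card < n →
      globalTrace F (φ - sumExtension ext u) = 0 := by
    induction n with
    | zero => exact ⟨0, fun F hF => absurd hF (Nat.not_lt_zero _)⟩
    | succ n ih =>
      obtain ⟨u, hu⟩ := ih
      have hv (F : T.faces) (hF : F.1.card = n) :
          (globalTrace F (φ - sumExtension ext u)).1 ∈ polyFormsVanishing r p q m F.1 :=
        globalTrace_mem_polyFormsVanishing fun G hG => hu G (hF ▸ Finset.card_lt_card hG)
      let v (F : T.faces) : polyFormsVanishing r p q m F.1 :=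
        if hF : F.1.card = n then ⟨_, hv F hF⟩ else 0
      refine ⟨u + v, fun F hF => ?_⟩
      have hvF := hext.globalTrace_sumExtension (u := v) (F := F) fun G hG => by
        have := Finset.card_lt_card hG
        exact dif_neg (by omega)
      rw [map_add, ← sub_sub, map_sub, sub_eq_zero]
      refine Subtype.ext ?_
      rw [hvF]
      by_cases hFn : F.1.card = n
      · simp [v, hFn]
      · rw [hu F (by omega)]
        simp [v, hFn]
  obtain ⟨u, hu⟩ := h ((Finset.univ.sup fun F : T.faces => F.1.card) + 1)
  refine ⟨u, (sub_eq_zero.1 (globalForms_ext fun F => ?_)).symm⟩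
  rw [hu F (Nat.lt_succ_iff.2 (Finset.le_sup (f := fun F : T.faces => F.1.card)
    (Finset.mem_univ F))), map_zero]

theorem IsLocalExtension.isInternal [DecidableEq T.faces] [Fintype T.faces]
    (hext : IsLocalExtension ext) :
    DirectSum.IsInternal (fun F : T.faces => LinearMap.range (ext F)) := by
  refine DirectSum.isInternal_submodule_of_iSupIndep_of_iSup_eq_top ?_ ?_
  · rw [iSupIndep_iff_finsetSum_eq_zero_imp_eq_zero]
    intro s φ hφ hsum
    choose! u hu using hφ
    have h0 : sumExtension ext (fun F => if F ∈ s then u F else 0) = 0 := by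
      rw [sumExtension_apply, ← hsum, ← Finset.sum_subset (Finset.subset_univ s)]
      · exact Finset.sum_congr rfl fun F hF => by simp [hF, hu F hF]
      · intro F _ hF
        simp [hF]
    intro F hF
    have := congr_fun (hext.sumExtension_injective (h0.trans (map_zero _).symm)) F
    rw [← hu F hF]
    simp only [hF, if_true] at this
    rw [this]
    exact map_zero _
  · rw [eq_top_iff]
    intro φ _
    obtain ⟨u, rfl⟩ := hext.sumExtension_surjective φ
    rw [sumExtension_apply]
    exact Submodule.sum_mem _ fun F _ => Submodule.mem_iSup_of_mem F ⟨u F, rfl⟩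

theorem IsLocalExtension.exists_basis [Fintype T.faces] (hext : IsLocalExtension ext)
    (ι : T.faces → Type*)
    (b : ∀ F : T.faces, Module.Basis (ι F) ℝ (polyFormsVanishing r p q m F.1)) :
    ∃ B : Module.Basis (Σ F : T.faces, ι F) ℝ (globalForms T r p q m),
      ∀ (F : T.faces) (i : ι F), B ⟨F, i⟩ = ext F (b F i) ∧
        ∀ G : T.faces, ¬ F.1 ⊆ G.1 → globalTrace G (B ⟨F, i⟩) = 0 := by
  classical
  have he : Function.Bijective (sumExtension ext) :=
    ⟨hext.sumExtension_injective, hext.sumExtension_surjective⟩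
  let B := (Pi.basis b).map (LinearEquiv.ofBijective (sumExtension ext) he)
  have hB (F : T.faces) (i : ι F) : B ⟨F, i⟩ = ext F (b F i) := by
    rw [Module.Basis.map_apply, Pi.basis_apply, LinearEquiv.ofBijective_apply, sumExtension_apply,
      Finset.sum_eq_single F]
    · simp
    · intro G _ hG
      simp [hG]
    · simp
  exact ⟨B, fun F i => ⟨hB F i, fun G hG => by rw [hB, hext.globalTrace_apply hG]⟩⟩

end Decomposition

end DoubleForm

end

open DoubleForm in
theorem mainTheorem3 {E : Type*} [AddCommGroup E] [Module ℝ E] [DecidableEq E]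
    (T : Geometry.SimplicialComplex ℝ E) (hT : T.faces.Finite)
    (r p q m : ℕ) (hqm : q ≤ p + m) (hmq : m ≤ q) (hrm : (r, m) ≠ (0, q)) :
    -- Local extension operators exist; they are induced by linear simplicial extension operators.
    (∃ (S : ∀ K : T.faces, polyFormsVanishing r p q m K.1 →ₗ[ℝ] homFormsVanishing r p q m K.1)
      (ext : ∀ K : T.faces, polyFormsVanishing r p q m K.1 →ₗ[ℝ] globalForms T r p q m),
      IsLocalExtension ext ∧
      ∀ (K F : T.faces) (φ : polyFormsVanishing r p q m K.1),
        IsBaryPullback K.1 F.1 (S K φ).1 (globalTrace F (ext K φ)).1) ∧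
    -- All local extension operators give a geometric decomposition and a local basis.
    ∀ ext : ∀ K : T.faces, polyFormsVanishing r p q m K.1 →ₗ[ℝ] globalForms T r p q m,
      IsLocalExtension ext →
        DirectSum.IsInternal (fun F : T.faces => LinearMap.range (ext F)) ∧
        ∀ (ι : T.faces → Type*)
          (b : ∀ F : T.faces, Module.Basis (ι F) ℝ (polyFormsVanishing r p q m F.1)),
          ∃ B : Module.Basis (Σ F : T.faces, ι F) ℝ (globalForms T r p q m),
            ∀ (F : T.faces) (i : ι F), B ⟨F, i⟩ = ext F (b F i) ∧
              ∀ G : T.faces, ¬ F.1 ⊆ G.1 → globalTrace G (B ⟨F, i⟩) = 0 := by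
  have : Fintype T.faces := hT.fintype
  exact ⟨exists_simplicial_local_extension T hmq hrm, fun ext hext =>
    ⟨hext.isInternal, fun ι b => hext.exists_basis ι b⟩⟩
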